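/- An MV-algebra is a structure $(A,\oplus,\neg,0)$ such that $(A,\oplus,0)$ is a commutative monoid and $\neg\neg x=x$, $x\oplus\neg 0=\neg 0$ and $\neg(\neg x\oplus y)\oplus y=\neg(\neg y\oplus x)\oplus x$ for all $x,y\in A$. In it put $u=\neg 0$, $x\odot y=\neg(\neg x\oplus\neg y)$, $x\ominus y=\neg(\neg x\oplus y)$, $x\wedge y=x\odot(\neg x\oplus y)$, and $x\le y$ if and only if $x\ominus y=0$. An MV-algebra with product is an MV-algebra $A$ together with an associative and commutative product $(a,b)\mapsto ab$ on $A$. Such an $A$ is called - an MVW-rig if $a0=0a=0$, $\big(a(b\oplus c)\big)\ominus(ab\oplus ac)=0$ and $(ab\ominus ac)\ominus\big(a(b\ominus c)\big)=0$ for all $a,b,c\in A$; - a $PMV$-algebra (in the sense of Di Nola and Dvurečenskij) if, for all $a,b,c\in A$, $a\odot b=0$ implies both $ac\odot bc=0$ and $c(a\oplus b)=ca\oplus cb$; - a $PMV_f$-algebra if it is an MVW-rig and $ab\le a\wedge b$ and $a(b\ominus c)=ab\ominus ac$ for all $a,b,c\in A$; - a $PMV_1$-algebra if $au=a$ and $a(b\ominus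 c)=ab\ominus ac$ for all $a,b,c\in A$. Write $PMV_1$, $PMV_f$, $PMV$ and $MVW\text{-rig}$ for the corresponding classes of algebras. **Theorem.** The following inclusions hold: $$PMV_1\subset PMV_f\subseteq PMV\subset MVW\text{-rig},$$ where the first and the last inclusion are strict. -/

import Mathlib

universe u

/-- An MV-algebra `(A, ⊕, ¬, 0)`.  The commutative monoid `(A, ⊕, 0)` is written additively
(`x + y` is `x ⊕ y`) and the negation of `x` is written `￢x`. -/
class MVAlgebra (A : Type u) extends AddCommMonoid A, HNot A where
  neg_neg' : ∀ x : A, ￢(￢x) = x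
  add_neg_zero : ∀ x : A, x + ￢(0 : A) = ￢(0 : A)
  neg_add_add_comm : ∀ x y : A, ￢(￢x + y) + y = ￢(￢y + x) + x

namespace MVAlgebra

variable {A : Type u} [MVAlgebra A]

/-- The greatest element `u = ¬0`. -/
def unit (A : Type u) [MVAlgebra A] : A := ￢(0 : A)

/-- `x ⊙ y = ¬(¬x ⊕ ¬y)`. -/
def odot (x y : A) : A := ￢(￢x + ￢y)

/-- `x ⊖ y = x ⊙ ¬y = ¬(¬x ⊕ y)`. -/
def ominus (x y : A) : A := ￢(￢x + y)

/-- The natural order: `x ≤ y` if and only if `x ⊖ y = 0`. -/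
def le (x y : A) : Prop := ominus x y = 0

/-- The infimum for the natural order: `x ∧ y = x ⊙ (¬x ⊕ y)`. -/
def inf (x y : A) : A := odot x (￢x + y)

end MVAlgebra

/-- An MV-algebra with (commutative) product: an MV-algebra together with a commutative
semigroup operation, with no compatibility required. -/
class MVAlgebraWithProduct (A : Type u) extends MVAlgebra A, CommSemigroup A

open MVAlgebra in
/-- MVW-rigs. -/
structure IsMVWRig (A : Type u) [MVAlgebraWithProduct A] : Prop where
  mul_zero' : ∀ a : A, a * 0 = 0
  zero_mul' : ∀ a : A, 0 * a = 0
  mul_add_ominus : ∀ a b c : A, ominus (a * (b + c)) (a * b + a * c) = 0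
  ominus_mul_ominus : ∀ a b c : A, ominus (ominus (a * b) (a * c)) (a * ominus b c) = 0

open MVAlgebra in
/-- PMV-algebras in the sense of Di Nola and Dvurečenskij. -/
structure IsPMV (A : Type u) [MVAlgebraWithProduct A] : Prop where
  odot_mul : ∀ a b c : A, odot a b = 0 → odot (a * c) (b * c) = 0
  mul_add' : ∀ a b c : A, odot a b = 0 → c * (a + b) = c * a + c * b

open MVAlgebra in
/-- `PMV_f`-algebras. -/
structure IsPMVf (A : Type u) [MVAlgebraWithProduct A] : Prop extends IsMVWRig A where
  mul_le_inf : ∀ a b : A, le (a * b) (inf a b)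
  mul_ominus : ∀ a b c : A, a * ominus b c = ominus (a * b) (a * c)

open MVAlgebra in
/-- Unitary PMV-algebras (`PMV_1`-algebras). -/
structure IsPMV1 (A : Type u) [MVAlgebraWithProduct A] : Prop where
  mul_unit : ∀ a : A, a * unit A = a
  mul_ominus : ∀ a b c : A, a * ominus b c = ominus (a * b) (a * c)

/-- The bundled MV-algebras with product whose carrier lies in `Type u`. -/
structure MVProductAlgebra : Type (u + 1) where
  carrier : Type u
  [inst : MVAlgebraWithProduct carrier]

attribute [instance] MVProductAlgebra.inst

/-- The class of all MVW-rigs. -/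
def MVWRig : Set MVProductAlgebra.{u} := {A | IsMVWRig A.carrier}

/-- The class of all PMV-algebras. -/
def PMV : Set MVProductAlgebra.{u} := {A | IsPMV A.carrier}

/-- The class of all `PMV_f`-algebras. -/
def PMVf : Set MVProductAlgebra.{u} := {A | IsPMVf A.carrier}

/-- The class of all `PMV_1`-algebras. -/
def PMV1 : Set MVProductAlgebra.{u} := {A | IsPMV1 A.carrier}

/-! Two facts about $\ominus$ drive everything: the adjunction $x\ominus y\le z\iff x\le z\oplus y$,
and the equivalence between adding orthogonal elements ($x\odot y=0$) and subtracting. A product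
distributing over $\ominus$ is monotone, and a unit then forces $ab\le a\wedge b$. In a PMV-algebra
every $b\le c$ splits as the orthogonal sum $c=(c\ominus b)\oplus b$, on which the product is
additive; this yields monotonicity and subdistributivity. Two products on the three-element chain
give strictness. -/

namespace MVAlgebra

variable {A : Type u} [MVAlgebra A]

theorem neg_neg (x : A) : ￢(￢x) = x := neg_neg' x

theorem neg_add_self (x : A) : ￢x + x = ￢(0 : A) := by
  have h := neg_add_add_comm (￢(0 : A)) x
  rwa [neg_neg, zero_add, add_neg_zero] at h

theorem le_iff (x y : A) : le x y ↔ ￢x + y = ￢(0 : A) := by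
  unfold le ominus
  exact ⟨fun h => by rw [← h, neg_neg], fun h => by rw [h, neg_neg]⟩

theorem le_refl (x : A) : le x x := (le_iff x x).2 (neg_add_self x)

theorem ominus_self (x : A) : ominus x x = 0 := le_refl x

theorem le_add_right (x y : A) : le x (x + y) := by
  rw [le_iff, ← add_assoc, neg_add_self, add_comm, add_neg_zero]

theorem le_unit (x : A) : le x (unit A) := (le_iff _ _).2 (add_neg_zero _)

theorem zero_le (x : A) : le 0 x := by
  simpa using le_add_right 0 x

theorem ominus_add_cancel {x y : A} (h : le x y) : ominus y x + x = y := by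
  rw [ominus, ← neg_add_add_comm, (le_iff x y).1 h, neg_neg, zero_add]

/-- Telescoping: $z=(z\ominus y)\oplus(y\ominus x)\oplus x$. -/
theorem le_trans {x y z : A} (hxy : le x y) (hyz : le y z) : le x z := by
  have h := le_add_right x (ominus z y + ominus y x)
  rwa [add_comm, add_assoc, ominus_add_cancel hxy, ominus_add_cancel hyz] at h

theorem add_le_add_right {x y : A} (h : le x y) (z : A) : le (x + z) (y + z) := by
  have k := le_add_right (x + z) (ominus y x)
  rwa [add_comm (x + z), ← add_assoc, ominus_add_cancel h] at k

theorem ominus_le_iff (x y z : A) : le (ominus x y) z ↔ le x (z + y) := by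
  rw [le_iff, le_iff, ominus, neg_neg, add_assoc, add_comm y z]

theorem le_ominus_add (x y : A) : le x (ominus x y + y) :=
  (ominus_le_iff _ _ _).1 (le_refl _)

theorem ominus_le_ominus_right {x y : A} (h : le x y) (z : A) : le (ominus x z) (ominus y z) :=
  (ominus_le_iff _ _ _).2 (le_trans h (le_ominus_add y z))

theorem add_ominus_le (x y : A) : le (ominus (x + y) y) x :=
  (ominus_le_iff _ _ _).2 (le_refl _)

theorem odot_eq_zero_iff (x y : A) : odot x y = 0 ↔ le x (￢y) := Iff.rfl

theorem odot_ominus_self (x y : A) : odot (ominus x y) y = 0 := by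
  rw [odot_eq_zero_iff, ominus_le_iff, le_iff, neg_add_self, add_neg_zero]

theorem add_ominus_cancel {x y : A} (h : odot x y = 0) : ominus (x + y) y = x := by
  have h' := (le_iff _ _).1 ((odot_eq_zero_iff x y).1 h)
  have k := neg_add_add_comm (￢x) y
  rw [neg_neg, add_comm (￢y), h', neg_neg, zero_add] at k
  rw [ominus, k, neg_neg]

theorem unit_ominus (x : A) : ominus (unit A) x = ￢x := by
  rw [ominus, unit, neg_neg, zero_add]

theorem inf_eq_ominus (x y : A) : inf x y = ominus x (ominus x y) := rfl

theorem inf_comm (x y : A) : inf x y = inf y x := by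
  have h := neg_add_add_comm (￢y) (￢x)
  rw [neg_neg, neg_neg, add_comm y, add_comm x] at h
  unfold inf odot
  rw [add_comm (￢x), h, add_comm (￢y) (￢(￢y + x))]

theorem le_inf {x y z : A} (hx : le z x) (hy : le z y) : le z (inf x y) := by
  have hz : inf z x = z := by
    rw [inf, odot, (le_iff z x).1 hx, neg_neg, add_comm, zero_add, neg_neg]
  -- Now $z=x\ominus(x\ominus z)$, so the claim reduces to $\ominus$ being antitone in its second
  -- argument.
  rw [← hz, inf_comm z x, inf_eq_ominus, inf_eq_ominus, ominus_le_iff]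
  have anti : le (ominus x y) (ominus x z) :=
    (ominus_le_iff _ _ _).2 <| le_trans (le_ominus_add x z) <| by
      rw [add_comm, add_comm _ y]; exact add_le_add_right hy _
  refine le_trans (le_ominus_add x (ominus x y)) ?_
  rw [add_comm, add_comm _ (ominus x z)]
  exact add_le_add_right anti _

end MVAlgebra

section Inclusions

open MVAlgebra

variable {A : Type u} [MVAlgebraWithProduct A]

theorem mul_zero_of_mul_ominus
    (h : ∀ a b c : A, a * ominus b c = ominus (a * b) (a * c)) (a : A) : a * 0 = 0 := by
  rw [← ominus_self (0 : A), h, ominus_self]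
  exact (ominus_self 0).symm

theorem mul_le_mul_left_of_mul_ominus
    (h : ∀ a b c : A, a * ominus b c = ominus (a * b) (a * c)) {b c : A} (hbc : le b c) (a : A) :
    le (a * b) (a * c) := by
  unfold le
  rw [← h, show ominus b c = 0 from hbc, mul_zero_of_mul_ominus h]

theorem IsPMV1.isPMVf (h : IsPMV1 A) : IsPMVf A where
  mul_zero' := mul_zero_of_mul_ominus h.mul_ominus
  zero_mul' a := by rw [mul_comm, mul_zero_of_mul_ominus h.mul_ominus]
  mul_add_ominus a b c := by
    change le _ _
    -- By adjunction it suffices that $a((b\oplus c)\ominus c)\le ab$.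
    rw [← ominus_le_iff, ← h.mul_ominus]
    exact mul_le_mul_left_of_mul_ominus h.mul_ominus (add_ominus_le b c) a
  ominus_mul_ominus a b c := by rw [h.mul_ominus, ominus_self]
  mul_le_inf a b := by
    have key (a b : A) : le (a * b) a := by
      simpa only [h.mul_unit] using mul_le_mul_left_of_mul_ominus h.mul_ominus (le_unit b) a
    exact le_inf (key a b) (by rw [mul_comm]; exact key b a)
  mul_ominus := h.mul_ominus

theorem IsPMVf.isPMV (h : IsPMVf A) : IsPMV A where
  odot_mul a b c hab := by
    rw [odot_eq_zero_iff] at hab ⊢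
    have hc := mul_le_mul_left_of_mul_ominus h.mul_ominus hab c
    rw [← unit_ominus b, h.mul_ominus] at hc
    -- $ca\le cu\ominus cb\le u\ominus cb=\neg(cb)$; no unit law is needed, only $cu\le u$.
    have hu := le_trans hc (ominus_le_ominus_right (le_unit (c * unit A)) (c * b))
    rwa [unit_ominus, mul_comm c a, mul_comm c b] at hu
  mul_add' a b c hab := by
    have hle : le (c * b) (c * (a + b)) :=
      mul_le_mul_left_of_mul_ominus h.mul_ominus (by rw [add_comm]; exact le_add_right b a) c
    rw [← ominus_add_cancel hle, ← h.mul_ominus, add_ominus_cancel hab]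

/-- Since $0\odot 0=0$, the element $a0$ is both idempotent for $\oplus$ and orthogonal to itself,
so cancellation kills it. -/
theorem IsPMV.mul_zero' (h : IsPMV A) (a : A) : a * 0 = 0 := by
  have h0 : odot (0 : A) 0 = 0 := (odot_eq_zero_iff _ _).2 (zero_le _)
  have hadd := h.mul_add' 0 0 a h0
  have hodot := h.odot_mul 0 0 a h0
  rw [mul_comm 0 a] at hodot
  have hc := add_ominus_cancel hodot
  rw [add_zero] at hadd
  rw [← hadd, ominus_self] at hc
  exact hc.symm

theorem IsPMV.mul_le_mul_left (h : IsPMV A) {b c : A} (hbc : le b c) (a : A) :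
    le (a * b) (a * c) := by
  rw [← ominus_add_cancel hbc, h.mul_add' _ _ _ (odot_ominus_self c b), add_comm]
  exact le_add_right _ _

/-- Replace $b\oplus c$ by the orthogonal sum $((b\oplus c)\ominus c)\oplus c$, whose first term is
at most $b$. -/
theorem IsPMV.mul_add_le (h : IsPMV A) (a b c : A) : le (a * (b + c)) (a * b + a * c) := by
  have hc : le c (b + c) := by rw [add_comm]; exact le_add_right c b
  have e := h.mul_add' _ _ a (odot_ominus_self (b + c) c)
  rw [ominus_add_cancel hc] at e
  rw [e]
  exact add_le_add_right (h.mul_le_mul_left (add_ominus_le b c) a) _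

theorem IsPMV.isMVWRig (h : IsPMV A) : IsMVWRig A where
  mul_zero' := h.mul_zero'
  zero_mul' a := by rw [mul_comm, h.mul_zero']
  mul_add_ominus := h.mul_add_le
  ominus_mul_ominus a b c :=
    (ominus_le_iff _ _ _).2 <|
      le_trans (h.mul_le_mul_left (le_ominus_add b c) a) (h.mul_add_le a _ c)

end Inclusions

/-- The underlying set of the three-element Łukasiewicz chain. -/
inductive LukasiewiczThree : Type u
  | zero
  | half
  | one

namespace LukasiewiczThree

/-- The truncated sum on the three-element chain. -/
def add : LukasiewiczThree.{u} → LukasiewiczThree.{u} → LukasiewiczThree.{u}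
  | zero, y => y
  | half, zero => half
  | half, _ => one
  | one, _ => one

/-- The negation `x ↦ 1 - x` on the three-element chain. -/
def neg : LukasiewiczThree.{u} → LukasiewiczThree.{u}
  | zero => one
  | half => half
  | one => zero

/-- The truncated integer product on the three-element chain, read as `{0, 1, 2}`. -/
def truncMul : LukasiewiczThree.{u} → LukasiewiczThree.{u} → LukasiewiczThree.{u}
  | zero, _ => zero
  | half, y => y
  | one, zero => zero
  | one, _ => one

instance : Add LukasiewiczThree.{u} := ⟨add⟩

instance : Zero LukasiewiczThree.{u} := ⟨zero⟩

instance addCommMonoid : AddCommMonoid LukasiewiczThree.{u} where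
  nsmul := nsmulRec
  add_assoc := by rintro (_ | _ | _) (_ | _ | _) (_ | _ | _) <;> rfl
  zero_add := by rintro (_ | _ | _) <;> rfl
  add_zero := by rintro (_ | _ | _) <;> rfl
  add_comm := by rintro (_ | _ | _) (_ | _ | _) <;> rfl

instance : MVAlgebra LukasiewiczThree.{u} where
  __ := addCommMonoid
  hnot := neg
  neg_neg' := by rintro (_ | _ | _) <;> rfl
  add_neg_zero := by rintro (_ | _ | _) <;> rfl
  neg_add_add_comm := by rintro (_ | _ | _) (_ | _ | _) <;> rfl

/-- The three-element chain with the product that is constantly zero. -/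
abbrev zeroProduct : MVAlgebraWithProduct LukasiewiczThree.{u} where
  mul _ _ := zero
  mul_assoc _ _ _ := rfl
  mul_comm _ _ := rfl

/-- The three-element chain with the truncated integer product. -/
abbrev truncProduct : MVAlgebraWithProduct LukasiewiczThree.{u} where
  mul := truncMul
  mul_assoc := by rintro (_ | _ | _) (_ | _ | _) (_ | _ | _) <;> rfl
  mul_comm := by rintro (_ | _ | _) (_ | _ | _) <;> rfl

theorem isPMVf_zeroProduct : @IsPMVf LukasiewiczThree.{u} zeroProduct :=
  letI := zeroProduct.{u}
  { mul_zero' := fun _ => rfl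
    zero_mul' := fun _ => rfl
    mul_add_ominus := fun _ _ _ => rfl
    ominus_mul_ominus := fun _ _ _ => rfl
    mul_le_inf := fun _ _ => MVAlgebra.zero_le _
    mul_ominus := fun _ _ _ => rfl }

theorem not_isPMV1_zeroProduct : ¬ @IsPMV1 LukasiewiczThree.{u} zeroProduct := fun h => by
  have h1 : zero = one := @IsPMV1.mul_unit _ zeroProduct h one
  cases h1

theorem isMVWRig_truncProduct : @IsMVWRig LukasiewiczThree.{u} truncProduct :=
  letI := truncProduct.{u}
  { mul_zero' := by rintro (_ | _ | _) <;> rfl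
    zero_mul' := by rintro (_ | _ | _) <;> rfl
    mul_add_ominus := by rintro (_ | _ | _) (_ | _ | _) (_ | _ | _) <;> rfl
    ominus_mul_ominus := by rintro (_ | _ | _) (_ | _ | _) (_ | _ | _) <;> rfl }

theorem not_isPMV_truncProduct : ¬ @IsPMV LukasiewiczThree.{u} truncProduct := fun h => by
  -- `half` is orthogonal to itself, but multiplying by `one` gives `one`, and $u\odot u=u$.
  have h1 : one = zero := @IsPMV.odot_mul _ truncProduct h half half one rfl
  cases h1

end LukasiewiczThree

theorem mainTheorem11 :
    PMV1.{u} ⊂ PMVf.{u} ∧ PMVf.{u} ⊆ PMV.{u} ∧ PMV.{u} ⊂ MVWRig.{u} := by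
  refine ⟨⟨fun _ h => IsPMV1.isPMVf h, fun h => ?_⟩, fun _ h => IsPMVf.isPMV h,
    ⟨fun _ h => IsPMV.isMVWRig h, fun h => ?_⟩⟩
  · exact LukasiewiczThree.not_isPMV1_zeroProduct
      (@h (@MVProductAlgebra.mk _ LukasiewiczThree.zeroProduct)
        LukasiewiczThree.isPMVf_zeroProduct)
  · exact LukasiewiczThree.not_isPMV_truncProduct
      (@h (@MVProductAlgebra.mk _ LukasiewiczThree.truncProduct)
        LukasiewiczThree.isMVWRig_truncProduct)
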